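/- **Conventions.** Work in $\mathsf{RCA}_0$: the theory in the language of second-order arithmetic saying that $\mathbb N$ is a discretely ordered commutative semiring with identity, together with the $\Sigma^0_1$ induction scheme and the $\Delta^0_1$ comprehension scheme. Ordered pairs are coded by $\langle i,j\rangle=(i+j)^2+i$, functions and binary relations are sets of coded pairs, and a set is finite if it is bounded. A quasi-order is a reflexive and transitive relation $\le_Q$ on a set $Q$, and a partial order is an antisymmetric quasi-order. Write $y<_Qz$ for $y\le_Q z\wedge z\nleq_Q y$, and $y\mid_Q z$ for $y\nleq_Q z\wedge z\nleq_Q y$. A wqo is a quasi-order $Q$ such that for every function $q\colon\mathbb N\to Q$ there are $m<n$ with $q(m)\le_Q q(n)$. Let $f\colon\mathbb N\to\mathbb N$ be an injection, $P$ a finite partial order and $x\in P$. For $s\in\mathbb N$ let $$T_s=\{n<s : \forall k\,(n<k\le s\rightarrow f(n)<f(k))\}.$$ Let $P_n=\{n\}\times P$ and $x_n=(n,x)$. The structure $Q=\Xi_f(P,x)$ has domain $\bigcup_{n\in\mathbb N}P_n$; on each $P_n$ the relation $\le_Q$ is the copy of $\le_P$; and for each $s$ the elements of $P_{s+1}$ are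 related to the elements of $\bigcup_{n\le s}P_n$ as follows. * If $T_{s+1}\subsetneq T_s\cup\{s\}$, let $n_0$ be the least element of $(T_s\cup\{s\})\setminus T_{s+1}$. Every $z\in P_{s+1}$ is (strictly) above all $y\in\bigcup_{n\le s}P_n$ with $y\le_Q x_{n_0}$, (strictly) below all such $y$ with $y>_Q x_{n_0}$, and incomparable with all such $y$ with $y\mid_Q x_{n_0}$. * If $T_{s+1}=T_s\cup\{s\}$, every $z\in P_{s+1}$ is (strictly) above all $y\in\bigcup_{n\le s}P_n$ with $y<_Q x_s$, (strictly) below all such $y$ with $y\ge_Q x_s$, and incomparable with all such $y$ with $y\mid_Q x_s$. **Lemma.** The following is provable in $\mathsf{RCA}_0$, that is, holds in every model of $\mathsf{RCA}_0$. For every injection $f\colon\mathbb N\to\mathbb N$, every finite partial order $P$ and every $x\in P$, the structure $Q=\Xi_f(P,x)$ exists, is uniquely determined by the clauses above, and is a partial order; and if $Q$ is not a wqo, then the range of $f$ exists, i.e. there is a set $X$ such that $\forall n\,(n\in X\leftrightarrow\exists m\,(f(m)=n))$. -/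

import Mathlib

/-! Second-order arithmetic and its subsystem `RCA₀`, treated through its (general, possibly
nonstandard) models. A structure for the language of second-order arithmetic is a first-order part
`M`, together with a collection `S : Set (Set M)` over which the set variables range. -/

namespace SOA

/-! ### Bounded-quantifier formulas -/

/-- Number terms. Number variables are de Bruijn indices. -/
inductive Term : Type
  | var (i : ℕ) : Term
  | zero : Term
  | one : Term
  | add (s t : Term) : Term
  | mul (s t : Term) : Term

/-- `Σ⁰₀` formulas (all quantifiers bounded), with number variables and set variables indexed
by `ℕ`. The remaining connectives and `∃ v < t` are expressible through negation. -/
inductive BddFormula : Type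
  | eq (s t : Term) : BddFormula
  | lt (s t : Term) : BddFormula
  | mem (t : Term) (i : ℕ) : BddFormula
  | neg (φ : BddFormula) : BddFormula
  | and (φ ψ : BddFormula) : BddFormula
  /-- `all t φ` is `∀ v < t, φ`; variable `0` of `φ` is `v`, and `t` does not mention `v`. -/
  | all (t : Term) (φ : BddFormula) : BddFormula

/-- Prepend a value to an assignment of the number variables. -/
def push {M : Type*} (a : M) (e : ℕ → M) : ℕ → M
  | 0 => a
  | n + 1 => e n

section

variable {M : Type*} [CommSemiring M]

def Term.eval (e : ℕ → M) : Term → M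
  | .var i => e i
  | .zero => 0
  | .one => 1
  | .add s t => s.eval e + t.eval e
  | .mul s t => s.eval e * t.eval e

/-- Satisfaction, under the assignment `V` of set variables and `e` of number variables. -/
def BddFormula.Sat [LinearOrder M] (V : ℕ → Set M) : (ℕ → M) → BddFormula → Prop
  | e, .eq s t => s.eval e = t.eval e
  | e, .lt s t => s.eval e < t.eval e
  | e, .mem t i => t.eval e ∈ V i
  | e, .neg φ => ¬ φ.Sat V e
  | e, .and φ ψ => φ.Sat V e ∧ ψ.Sat V e
  | e, .all t φ => ∀ a : M, a < t.eval e → φ.Sat V (push a e)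

/-- The property of `n` given by the `Σ⁰₁` formula `∃ m, θ(m, n)` with number parameters `e` and
set parameters `V`. -/
def SigmaOne [LinearOrder M] (θ : BddFormula) (V : ℕ → Set M) (e : ℕ → M) (n : M) : Prop :=
  ∃ m : M, θ.Sat V (push m (push n e))

/-- The property of `n` given by the `Π⁰₁` formula `∀ m, θ(m, n)` with number parameters `e` and
set parameters `V`. -/
def PiOne [LinearOrder M] (θ : BddFormula) (V : ℕ → Set M) (e : ℕ → M) (n : M) : Prop :=
  ∀ m : M, θ.Sat V (push m (push n e))

end

/-- `(M, S)` is a model of `RCA₀`: `M` is a discretely ordered commutative semiring with identity,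
and `(M, S)` satisfies the `Σ⁰₁` induction scheme and the `Δ⁰₁` comprehension scheme, with
parameters from `M` and `S`. -/
structure ModelsRCA0 {M : Type*} [CommSemiring M] [LinearOrder M] [IsStrictOrderedRing M]
    (S : Set (Set M)) : Prop where
  nonempty : S.Nonempty
  nonneg : ∀ a : M, 0 ≤ a
  discrete : ∀ a b : M, a < b ↔ a + 1 ≤ b
  induction : ∀ (θ : BddFormula) (V : ℕ → Set M) (e : ℕ → M), (∀ i, V i ∈ S) →
    SigmaOne θ V e 0 → (∀ n, SigmaOne θ V e n → SigmaOne θ V e (n + 1)) →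
    ∀ n, SigmaOne θ V e n
  comprehension : ∀ (θ η : BddFormula) (V : ℕ → Set M) (e : ℕ → M), (∀ i, V i ∈ S) →
    (∀ n, SigmaOne θ V e n ↔ PiOne η V e n) → {n | SigmaOne θ V e n} ∈ S

/-! ### Functions, relations and orders inside a model -/

section

variable {M : Type*} [CommSemiring M]

/-- The usual code of an ordered pair of numbers. -/
def pair (a b : M) : M := (a + b) ^ 2 + a

/-- `f` is (given by) a function `ℕ → ℕ` of the model: its graph is a set of the model. -/
def IsFunction (S : Set (Set M)) (f : M → M) : Prop :=
  {z | ∃ n, z = pair n (f n)} ∈ S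

/-- `r` is (given by) a binary relation of the model. -/
def IsRelation (S : Set (Set M)) (r : M → M → Prop) : Prop :=
  {z | ∃ a b, r a b ∧ z = pair a b} ∈ S

/-- Finiteness of a set, in the sense of the model. -/
def IsFinite [LinearOrder M] (X : Set M) : Prop := ∃ k : M, ∀ i ∈ X, i < k

/-- `(Q, le)` is a quasi-order of the model `(M, S)`. -/
structure IsQuasiOrder (S : Set (Set M)) (Q : Set M) (le : M → M → Prop) : Prop where
  mem : Q ∈ S
  isRelation : IsRelation S le
  supp : ∀ a b, le a b → a ∈ Q ∧ b ∈ Q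
  refl : ∀ a ∈ Q, le a a
  trans : ∀ a b c, le a b → le b c → le a c

/-- `(Q, le)` is a partial order of the model `(M, S)`. -/
structure IsPartialOrder (S : Set (Set M)) (Q : Set M) (le : M → M → Prop) : Prop
    extends IsQuasiOrder S Q le where
  antisymm : ∀ a b, le a b → le b a → a = b

/-- `(Q, le)` is a well-quasi-order in the sense of the model `(M, S)`: a quasi-order such that no
sequence of the model is bad. -/
def IsWQO [LinearOrder M] (S : Set (Set M)) (Q : Set M) (le : M → M → Prop) : Prop :=
  IsQuasiOrder S Q le ∧
    ∀ q : M → M, IsFunction S q → (∀ n, q n ∈ Q) → ∃ m n, m < n ∧ le (q m) (q n)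

end

/-! ### The order `Ξ_f(P, x)` -/

section

variable {M : Type*}

/-- Strictly below. -/
def Lt (le : M → M → Prop) (a b : M) : Prop := le a b ∧ ¬ le b a

/-- Incomparable. -/
def Incomp (le : M → M → Prop) (a b : M) : Prop := ¬ le a b ∧ ¬ le b a

/-- With respect to `D`, the elements of `Z` are placed immediately above `w`. -/
def PlacedAbove (le : M → M → Prop) (D Z : Set M) (w : M) : Prop :=
  ∀ y ∈ D, ∀ z ∈ Z,
    (le y w → Lt le y z) ∧ (Lt le w y → Lt le z y) ∧ (Incomp le y w → Incomp le y z)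

/-- With respect to `D`, the elements of `Z` are placed immediately below `w`. -/
def PlacedBelow (le : M → M → Prop) (D Z : Set M) (w : M) : Prop :=
  ∀ y ∈ D, ∀ z ∈ Z,
    (Lt le y w → Lt le y z) ∧ (le w y → Lt le z y) ∧ (Incomp le y w → Incomp le y z)

variable [CommSemiring M] [LinearOrder M]

/-- `T_s`: the set of all `n < s` that are `f`-true at stage `s`. -/
def trueAt (f : M → M) (s : M) : Set M :=
  {n | n < s ∧ ∀ k, n < k → k ≤ s → f n < f k}

/-- `P_n`: the `n`-th copy of `P`. -/
def copy (P : Set M) (n : M) : Set M := {z | ∃ p ∈ P, z = pair n p}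

/-- The union of the copies `P_n` with `n ≤ s`. -/
def copiesUpTo (P : Set M) (s : M) : Set M := {z | ∃ n, n ≤ s ∧ z ∈ copy P n}

/-- `(Q, leQ)` is the structure `Ξ_f(P, x)` as constructed in the model `(M, S)`. -/
structure IsXi (S : Set (Set M)) (f : M → M) (P : Set M) (leP : M → M → Prop) (x : M)
    (Q : Set M) (leQ : M → M → Prop) : Prop where
  mem : Q ∈ S
  isRelation : IsRelation S leQ
  supp : ∀ a b, leQ a b → a ∈ Q ∧ b ∈ Q
  domain : ∀ z, z ∈ Q ↔ ∃ n, z ∈ copy P n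
  /-- On each copy of `P` the order is that of `P`. -/
  onCopy : ∀ n, ∀ p ∈ P, ∀ p' ∈ P, (leQ (pair n p) (pair n p') ↔ leP p p')
  /-- Stage `s + 1`, first case. -/
  above : ∀ s n₀, trueAt f (s + 1) ⊂ trueAt f s ∪ {s} →
    IsLeast ((trueAt f s ∪ {s}) \ trueAt f (s + 1)) n₀ →
    PlacedAbove leQ (copiesUpTo P s) (copy P (s + 1)) (pair n₀ x)
  /-- Stage `s + 1`, second case. -/
  below : ∀ s, trueAt f (s + 1) = trueAt f s ∪ {s} →
    PlacedBelow leQ (copiesUpTo P s) (copy P (s + 1)) (pair s x)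

end

end SOA

/-! Comparing (m,p) with (n,q), m < n, does not need the recursion over stages: the answer depends
only on whether m is true at n and, if not, on whether some i < m true at m has stopped being true
at n. This gives a bounded formula (`XiRel`), so Δ⁰₁ comprehension provides the order, and
`ModelsRCA0.isXi_xiLe` checks the clauses. Each clause makes the new copy imitate one old element w
against all earlier elements, so uniqueness (`IsXi.unique`) and the order axioms
(`IsXi.isPartialOrder`) follow by induction on the stage; finiteness of P bounds the quantifiers
over the first s copies.

If some number true at m is no longer true at n > m, then all of P_m lies below all of P_n. A bad
sequence is injective, hence visits arbitrarily late copies; so a number true at the index of a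
visited copy can never become false, since a later term would then lie above an earlier one. The
sequence thus enumerates genuinely true numbers, on which f is unbounded, and v is outside the range
exactly when some enumerated a has f(a) > v and v is not among f(0), …, f(a). The range is therefore
Δ⁰₁ (`ModelsRCA0.range_mem_of_bad`).

Unboundedness of injections is a pigeonhole principle, proved in `ModelsRCA0.exists_ge` with Gödel's
coprime moduli. Definability is handled semantically: `IsBdd` and `IsSigma` are closed under the
logical operations, and each set of the model may be used as an atomic predicate. -/

namespace SOA

/-! ### Renaming of variables -/

/-- Rename the variables of a term. -/
def Term.ren (ρ : ℕ → ℕ) : Term → Term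
  | .var i => .var (ρ i)
  | .zero => .zero
  | .one => .one
  | .add s t => .add (s.ren ρ) (t.ren ρ)
  | .mul s t => .mul (s.ren ρ) (t.ren ρ)

/-- The renaming `ρ` under a binder. -/
def liftRen (ρ : ℕ → ℕ) : ℕ → ℕ
  | 0 => 0
  | n + 1 => ρ n + 1

/-- Rename the set variables by `g` and the number variables by `ρ`. -/
def BddFormula.ren (g : ℕ → ℕ) : (ℕ → ℕ) → BddFormula → BddFormula
  | ρ, .eq s t => .eq (s.ren ρ) (t.ren ρ)
  | ρ, .lt s t => .lt (s.ren ρ) (t.ren ρ)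
  | ρ, .mem t i => .mem (t.ren ρ) (g i)
  | ρ, .neg φ => .neg (φ.ren g ρ)
  | ρ, .and φ ψ => .and (φ.ren g ρ) (ψ.ren g ρ)
  | ρ, .all t φ => .all (t.ren ρ) (φ.ren g (liftRen ρ))

/-- Interleave two sequences. -/
def interleave {α : Type*} (u v : ℕ → α) (i : ℕ) : α := if i % 2 = 0 then u (i / 2) else v (i / 2)

theorem interleave_even {α : Type*} (u v : ℕ → α) (i : ℕ) : interleave u v (2 * i) = u i := by
  simp [interleave]

theorem interleave_odd {α : Type*} (u v : ℕ → α) (i : ℕ) : interleave u v (2 * i + 1) = v i := by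
  have : (2 * i + 1) / 2 = i := by omega
  simp [interleave, this]

variable {M : Type*}

theorem Term.eval_ren [CommSemiring M] (ρ : ℕ → ℕ) (e : ℕ → M) (t : Term) :
    (t.ren ρ).eval e = t.eval (fun i => e (ρ i)) := by
  induction t <;> simp_all [Term.ren, Term.eval]

theorem push_liftRen (a : M) (e : ℕ → M) (ρ : ℕ → ℕ) :
    (fun i => push a e (liftRen ρ i)) = push a (fun i => e (ρ i)) := by
  funext i
  cases i <;> rfl

theorem BddFormula.sat_ren [CommSemiring M] [LinearOrder M] (V : ℕ → Set M) (g : ℕ → ℕ)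
    (φ : BddFormula) :
    ∀ (ρ : ℕ → ℕ) (e : ℕ → M),
      (φ.ren g ρ).Sat V e ↔ φ.Sat (fun i => V (g i)) (fun i => e (ρ i)) := by
  induction φ with
  | eq s t => intro ρ e; simp [BddFormula.ren, BddFormula.Sat, Term.eval_ren]
  | lt s t => intro ρ e; simp [BddFormula.ren, BddFormula.Sat, Term.eval_ren]
  | mem t i => intro ρ e; simp [BddFormula.ren, BddFormula.Sat, Term.eval_ren]
  | neg φ ih => intro ρ e; simp [BddFormula.ren, BddFormula.Sat, ih]
  | and φ ψ ih₁ ih₂ => intro ρ e; simp [BddFormula.ren, BddFormula.Sat, ih₁, ih₂]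
  | all t φ ih =>
    intro ρ e
    simp [BddFormula.ren, BddFormula.Sat, ih, Term.eval_ren, push_liftRen]

/-! ### Definable functions and predicates, with parameters -/

/-- The assignment given by `σ`, where each variable is a constant or a variable of `e`. -/
def assign (σ : ℕ → M ⊕ ℕ) (e : ℕ → M) (i : ℕ) : M := Sum.elim id e (σ i)

theorem assign_interleave_even (σ σ' : ℕ → M ⊕ ℕ) (e : ℕ → M) :
    (fun i => assign (interleave σ σ') e (2 * i)) = assign σ e := by
  funext i
  simp only [assign, interleave_even]

theorem assign_interleave_odd (σ σ' : ℕ → M ⊕ ℕ) (e : ℕ → M) :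
    (fun i => assign (interleave σ σ') e (2 * i + 1)) = assign σ' e := by
  funext i
  simp only [assign, interleave_odd]

/-- This allows quantification over a variable of a formula with parameters. Slots reading the bound
variable are sent to index 0, all others to their shifted position; the value of `σ'` at a slot of
the first kind is never read. -/
theorem exists_ren_push (σ : ℕ → M ⊕ ℕ) : ∃ (ρ : ℕ → ℕ) (σ' : ℕ → M ⊕ ℕ), ∀ (a : M) (e : ℕ → M),
    (fun i => push a (assign σ' e) (ρ i)) = assign σ (push a e) := by
  refine ⟨fun i => match σ i with
    | .inr 0 => 0
    | _ => i + 1, fun i => match σ i with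
    | .inl c => .inl c
    | .inr 0 => .inr 0
    | .inr (j + 1) => .inr j, fun a e => ?_⟩
  funext i
  rcases h : σ i with c | (_ | j) <;> simp [assign, h, push]

variable [CommSemiring M]

/-- `t` is given by a number term with parameters. -/
def IsTermFn (t : (ℕ → M) → M) : Prop :=
  ∃ (τ : Term) (σ : ℕ → M ⊕ ℕ), ∀ e, τ.eval (assign σ e) = t e

theorem IsTermFn.var (i : ℕ) : IsTermFn (fun e : ℕ → M => e i) :=
  ⟨.var 0, fun _ => .inr i, fun _ => rfl⟩

theorem IsTermFn.const (c : M) : IsTermFn (fun _ : ℕ → M => c) :=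
  ⟨.var 0, fun _ => .inl c, fun _ => rfl⟩

/-- Interleaving the two parameter lists lets both terms be evaluated under one assignment. -/
theorem IsTermFn.merge {s t : (ℕ → M) → M} (hs : IsTermFn s) (ht : IsTermFn t) :
    ∃ (τ₁ τ₂ : Term) (σ : ℕ → M ⊕ ℕ), ∀ e,
      τ₁.eval (assign σ e) = s e ∧ τ₂.eval (assign σ e) = t e := by
  obtain ⟨τ₁, σ₁, h₁⟩ := hs
  obtain ⟨τ₂, σ₂, h₂⟩ := ht
  refine ⟨τ₁.ren (2 * ·), τ₂.ren (2 * · + 1), interleave σ₁ σ₂, fun e => ?_⟩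
  rw [Term.eval_ren, Term.eval_ren, assign_interleave_even, assign_interleave_odd]
  exact ⟨h₁ e, h₂ e⟩

theorem IsTermFn.add {s t : (ℕ → M) → M} (hs : IsTermFn s) (ht : IsTermFn t) :
    IsTermFn (fun e => s e + t e) := by
  obtain ⟨τ₁, τ₂, σ, h⟩ := hs.merge ht
  exact ⟨.add τ₁ τ₂, σ, fun e => by simp [Term.eval, h e]⟩

theorem IsTermFn.mul {s t : (ℕ → M) → M} (hs : IsTermFn s) (ht : IsTermFn t) :
    IsTermFn (fun e => s e * t e) := by
  obtain ⟨τ₁, τ₂, σ, h⟩ := hs.merge ht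
  exact ⟨.mul τ₁ τ₂, σ, fun e => by simp [Term.eval, h e]⟩

theorem IsTermFn.pair {s t : (ℕ → M) → M} (hs : IsTermFn s) (ht : IsTermFn t) :
    IsTermFn (fun e => pair (s e) (t e)) := by
  simp only [SOA.pair, sq]
  exact ((hs.add ht).mul (hs.add ht)).add hs

variable [LinearOrder M] {S : Set (Set M)}

/-- `A` is given by a `Σ⁰₀` formula with parameters from `M` and `S`. -/
def IsBdd (S : Set (Set M)) (A : (ℕ → M) → Prop) : Prop :=
  S.Nonempty → ∃ (θ : BddFormula) (V : ℕ → Set M) (σ : ℕ → M ⊕ ℕ), (∀ i, V i ∈ S) ∧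
    ∀ e, θ.Sat V (assign σ e) ↔ A e

/-- No set occurs here, but the set variables must still be assigned members of `S`; this is what
the nonemptiness guard in `IsBdd` is for. -/
theorem IsBdd.eq {s t : (ℕ → M) → M} (hs : IsTermFn s) (ht : IsTermFn t) :
    IsBdd S (fun e => s e = t e) := by
  rintro ⟨X, hX⟩
  obtain ⟨τ₁, τ₂, σ, h⟩ := hs.merge ht
  exact ⟨.eq τ₁ τ₂, fun _ => X, σ, fun _ => hX, fun e => by simp [BddFormula.Sat, h e]⟩

theorem IsBdd.lt {s t : (ℕ → M) → M} (hs : IsTermFn s) (ht : IsTermFn t) :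
    IsBdd S (fun e => s e < t e) := by
  rintro ⟨X, hX⟩
  obtain ⟨τ₁, τ₂, σ, h⟩ := hs.merge ht
  exact ⟨.lt τ₁ τ₂, fun _ => X, σ, fun _ => hX, fun e => by simp [BddFormula.Sat, h e]⟩

theorem IsBdd.mem {t : (ℕ → M) → M} {X : Set M} (hX : X ∈ S) (ht : IsTermFn t) :
    IsBdd S (fun e => t e ∈ X) := by
  obtain ⟨τ, σ, h⟩ := ht
  exact fun _ => ⟨.mem τ 0, fun _ => X, σ, fun _ => hX, fun e => by simp [BddFormula.Sat, h e]⟩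

theorem IsBdd.not {A : (ℕ → M) → Prop} (hA : IsBdd S A) : IsBdd S (fun e => ¬ A e) := by
  intro hne
  obtain ⟨θ, V, σ, hV, h⟩ := hA hne
  exact ⟨.neg θ, V, σ, hV, fun e => by simp [BddFormula.Sat, h e]⟩

theorem IsBdd.congr {A B : (ℕ → M) → Prop} (hA : IsBdd S A) (h : ∀ e, A e ↔ B e) :
    IsBdd S B := by
  rwa [show B = A from funext fun e => propext (h e).symm]

theorem IsBdd.and {A B : (ℕ → M) → Prop} (hA : IsBdd S A) (hB : IsBdd S B) :
    IsBdd S (fun e => A e ∧ B e) := by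
  intro hne
  obtain ⟨θ₁, V₁, σ₁, hV₁, h₁⟩ := hA hne
  obtain ⟨θ₂, V₂, σ₂, hV₂, h₂⟩ := hB hne
  refine ⟨.and (θ₁.ren (2 * ·) (2 * ·)) (θ₂.ren (2 * · + 1) (2 * · + 1)), interleave V₁ V₂,
    interleave σ₁ σ₂, fun i => ?_, fun e => ?_⟩
  · unfold interleave
    split_ifs
    exacts [hV₁ _, hV₂ _]
  · simp only [BddFormula.Sat, BddFormula.sat_ren, assign_interleave_even, assign_interleave_odd,
      interleave_even, interleave_odd]
    exact and_congr (h₁ e) (h₂ e)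

theorem IsBdd.or {A B : (ℕ → M) → Prop} (hA : IsBdd S A) (hB : IsBdd S B) :
    IsBdd S (fun e => A e ∨ B e) :=
  (hA.not.and hB.not).not.congr fun e => by tauto

theorem IsBdd.imp {A B : (ℕ → M) → Prop} (hA : IsBdd S A) (hB : IsBdd S B) :
    IsBdd S (fun e => A e → B e) :=
  (hA.and hB.not).not.congr fun e => by tauto

theorem IsBdd.iff {A B : (ℕ → M) → Prop} (hA : IsBdd S A) (hB : IsBdd S B) :
    IsBdd S (fun e => A e ↔ B e) :=
  ((hA.imp hB).and (hB.imp hA)).congr fun e => by tauto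

theorem IsBdd.le {s t : (ℕ → M) → M} (hs : IsTermFn s) (ht : IsTermFn t) :
    IsBdd S (fun e => s e ≤ t e) :=
  (IsBdd.lt ht hs).not.congr fun _ => not_lt

theorem IsBdd.ball {t : (ℕ → M) → M} {A : M → (ℕ → M) → Prop} (ht : IsTermFn t)
    (hA : IsBdd S (fun e => A (e 0) (fun i => e (i + 1)))) :
    IsBdd S (fun e => ∀ a < t e, A a e) := by
  intro hne
  obtain ⟨τ, σ₁, h₁⟩ := ht
  obtain ⟨θ, V, σ, hV, h⟩ := hA hne
  obtain ⟨ρ, σ₂, h₂⟩ := exists_ren_push σ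
  refine ⟨.all (τ.ren (2 * ·)) ((θ.ren id ρ).ren id (liftRen (2 * · + 1))), V,
    interleave σ₁ σ₂, hV, fun e => ?_⟩
  simp only [BddFormula.Sat, BddFormula.sat_ren, Term.eval_ren, assign_interleave_even, id, h₁]
  refine forall₂_congr fun a _ => ?_
  have : (fun i => push a (assign (interleave σ₁ σ₂) e) (liftRen (2 * · + 1) (ρ i))) =
      assign σ (push a e) := by
    rw [← h₂]
    funext i
    have := congrFun (push_liftRen a (assign (interleave σ₁ σ₂) e) (2 * · + 1)) (ρ i)
    simpa only [assign_interleave_odd] using this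
  rw [this]
  exact h (push a e)

theorem IsBdd.bex {t : (ℕ → M) → M} {A : M → (ℕ → M) → Prop} (ht : IsTermFn t)
    (hA : IsBdd S (fun e => A (e 0) (fun i => e (i + 1)))) :
    IsBdd S (fun e => ∃ a < t e, A a e) :=
  (IsBdd.ball (A := fun a e => ¬ A a e) ht hA.not).not.congr fun e => by simp

theorem IsBdd.comp {A : (ℕ → M) → Prop} (hA : IsBdd S A) (ρ : ℕ → ℕ) :
    IsBdd S (fun e => A (fun i => e (ρ i))) := by
  intro hne
  obtain ⟨θ, V, σ, hV, h⟩ := hA hne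
  refine ⟨θ, V, fun i => (σ i).map id ρ, hV, fun e => ?_⟩
  have : assign (fun i => (σ i).map id ρ) e = assign σ (fun i => e (ρ i)) := by
    funext i
    rcases hi : σ i with c | j <;> simp [assign, hi]
  rw [this]
  exact h _

theorem IsBdd.exists_formula {A : (ℕ → M) → Prop} (hA : IsBdd S A) (hne : S.Nonempty) :
    ∃ (θ : BddFormula) (V : ℕ → Set M) (c : ℕ → M), (∀ i, V i ∈ S) ∧
      ∀ m n, θ.Sat V (push m (push n c)) ↔ A (push m (push n fun _ => 0)) := by
  obtain ⟨θ, V, σ, hV, h⟩ := hA hne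
  obtain ⟨ρ₁, σ₁, h₁⟩ := exists_ren_push σ
  obtain ⟨ρ₂, σ₂, h₂⟩ := exists_ren_push σ₁
  refine ⟨θ.ren id (fun i => liftRen ρ₂ (ρ₁ i)), V, assign σ₂ fun _ => 0, hV, fun m n => ?_⟩
  rw [BddFormula.sat_ren, ← h, ← h₁, ← h₂, ← push_liftRen m (push n (assign σ₂ fun _ => 0)) ρ₂]
  rfl

/-! ### Σ⁰₁ predicates, induction and comprehension -/

/-- `A` is given by a `Σ⁰₁` formula with parameters from `M` and `S`. -/
def IsSigma (S : Set (Set M)) (A : (ℕ → M) → Prop) : Prop :=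
  ∃ B, IsBdd S B ∧ ∀ e, A e ↔ ∃ m, B (push m e)

theorem IsBdd.isSigma {A : (ℕ → M) → Prop} (hA : IsBdd S A) : IsSigma S A :=
  ⟨_, hA.comp (· + 1), fun _ => ⟨fun h => ⟨0, h⟩, fun ⟨_, h⟩ => h⟩⟩

theorem IsSigma.congr {A B : (ℕ → M) → Prop} (hA : IsSigma S A) (h : ∀ e, A e ↔ B e) :
    IsSigma S B := by
  rwa [show B = A from funext fun e => propext (h e).symm]

theorem IsSigma.and_isBdd {A B : (ℕ → M) → Prop} (hA : IsSigma S A) (hB : IsBdd S B) :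
    IsSigma S (fun e => A e ∧ B e) := by
  obtain ⟨A', hA', h⟩ := hA
  refine ⟨fun e => A' e ∧ B (fun i => e (i + 1)), hA'.and (hB.comp (· + 1)), fun e => ?_⟩
  exact (and_congr_left' (h e)).trans exists_and_right.symm

theorem IsSigma.or {A B : (ℕ → M) → Prop} (hA : IsSigma S A) (hB : IsSigma S B) :
    IsSigma S (fun e => A e ∨ B e) := by
  obtain ⟨A', hA', h⟩ := hA
  obtain ⟨B', hB', h'⟩ := hB
  exact ⟨_, hA'.or hB', fun e => (or_congr (h e) (h' e)).trans exists_or.symm⟩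

/-- Two unbounded existential quantifiers contract to one: a single number bounds both witnesses. -/
theorem IsSigma.ex [IsStrictOrderedRing M] {A : M → (ℕ → M) → Prop}
    (hA : IsSigma S (fun e => A (e 0) (fun i => e (i + 1)))) :
    IsSigma S (fun e => ∃ a, A a e) := by
  obtain ⟨B, hB, h⟩ := hA
  refine ⟨fun e => ∃ a < e 0, ∃ m < e 0, B (push m (push a fun i => e (i + 1))), ?_, fun e => ?_⟩
  · refine IsBdd.bex (A := fun a e => ∃ m < e 0, B (push m (push a fun i => e (i + 1))))
      (.var 0) ?_
    refine IsBdd.bex (A := fun m e => B (push m (push (e 0) fun i => e (i + 1 + 1)))) (.var 1) ?_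
    -- The variables are now m, a, the common bound, and then the original ones; the renaming skips
    -- the bound.
    convert hB.comp (fun | 0 => 0 | 1 => 1 | n + 2 => n + 3) using 3 with e
    funext i
    rcases i with _ | _ | i <;> rfl
  · constructor
    · rintro ⟨a, ha⟩
      obtain ⟨m, hm⟩ := (h (push a e)).1 ha
      exact ⟨max a m + 1, a, (le_max_left a m).trans_lt (lt_add_one _), m,
        (le_max_right a m).trans_lt (lt_add_one _), hm⟩
    · rintro ⟨_, a, _, m, _, hm⟩
      exact ⟨a, (h (push a e)).2 ⟨m, hm⟩⟩

variable [IsStrictOrderedRing M]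

theorem ModelsRCA0.induct (hS : ModelsRCA0 S) {A : M → Prop} (hA : IsSigma S fun e => A (e 0))
    (zero : A 0) (succ : ∀ n, A n → A (n + 1)) (n : M) : A n := by
  obtain ⟨B, hB, h⟩ := hA
  obtain ⟨θ, V, c, hV, hθ⟩ := hB.exists_formula hS.nonempty
  have key : ∀ n, SigmaOne θ V c n ↔ A n := fun n =>
    (exists_congr fun m => hθ m n).trans (h (push n fun _ => 0)).symm
  have := hS.induction θ V c hV
  simp only [key] at this
  exact this zero succ n

/-- The scheme wants one parameter list for both formulas, so the two lists are interleaved; the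
double lift leaves the two number variables in place. -/
theorem ModelsRCA0.mem_of_isSigma (hS : ModelsRCA0 S) {A : M → Prop}
    (hA : IsSigma S fun e => A (e 0)) (hA' : IsSigma S fun e => ¬ A (e 0)) : {n | A n} ∈ S := by
  obtain ⟨B, hB, h⟩ := hA
  obtain ⟨B', hB', h'⟩ := hA'
  obtain ⟨θ, V, c, hV, hθ⟩ := hB.exists_formula hS.nonempty
  obtain ⟨θ', V', c', hV', hθ'⟩ := hB'.exists_formula hS.nonempty
  have key : ∀ (ρ : ℕ → ℕ) (u : ℕ → M) (m n : M),
      (fun i => push m (push n u) (liftRen (liftRen ρ) i)) =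
        push m (push n fun i => u (ρ i)) := fun ρ u m n => by
    rw [push_liftRen, push_liftRen]
  have key₁ : ∀ n, SigmaOne (θ.ren (2 * ·) (liftRen (liftRen (2 * ·)))) (interleave V V')
      (interleave c c') n ↔ A n := fun n => by
    refine Iff.trans (exists_congr fun m => ?_) (h (push n fun _ => 0)).symm
    simp only [BddFormula.sat_ren, key, interleave_even]
    exact hθ m n
  have key₂ : ∀ n, PiOne (.neg (θ'.ren (2 * · + 1) (liftRen (liftRen (2 * · + 1)))))
      (interleave V V') (interleave c c') n ↔ A n := fun n => by
    rw [← not_not (a := A n), show (¬ A n) ↔ _ from h' (push n fun _ => 0), not_exists]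
    refine forall_congr' fun m => not_congr ?_
    simp only [BddFormula.sat_ren, key, interleave_odd]
    exact hθ' m n
  have := hS.comprehension _ _ _ _ (fun i => ?_) (fun n => (key₁ n).trans (key₂ n).symm)
  · simpa only [key₁] using this
  · unfold interleave
    split_ifs
    exacts [hV _, hV' _]

theorem ModelsRCA0.mem_of_isBdd (hS : ModelsRCA0 S) {A : M → Prop}
    (hA : IsBdd S fun e => A (e 0)) : {n | A n} ∈ S :=
  hS.mem_of_isSigma hA.isSigma hA.not.isSigma

end SOA

namespace SOA

variable {M : Type*} [CommSemiring M] [LinearOrder M] [IsStrictOrderedRing M] {S : Set (Set M)}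

/-! ### Arithmetic in models of `RCA₀` -/

theorem ModelsRCA0.lt_succ (hS : ModelsRCA0 S) (a b : M) : a < b + 1 ↔ a ≤ b := by
  rw [hS.discrete, add_le_add_iff_right]

theorem ModelsRCA0.add_sq_lt (hS : ModelsRCA0 S) {a b c : M} (h : a + b < c) :
    pair a b < c ^ 2 := by
  have h₁ := pow_le_pow_left₀ (hS.nonneg _) ((hS.discrete _ _).1 h) 2
  have h₂ := hS.nonneg b
  have h₃ := hS.nonneg a
  have h₄ : (a + b + 1) ^ 2 = (a + b) ^ 2 + a + (a + b + b + 1) := by ring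
  have h₅ : pair a b = (a + b) ^ 2 + a := rfl
  have h₆ := one_pos (α := M)
  grind

/-- The code lies between (a+b)² and (a+b+1)², so it determines a + b, and then a. -/
theorem ModelsRCA0.pair_inj (hS : ModelsRCA0 S) {a b c d : M} :
    pair a b = pair c d ↔ a = c ∧ b = d := by
  refine ⟨fun h => ?_, fun h => by rw [h.1, h.2]⟩
  have key : ∀ a b c d : M, a + b < c + d → pair a b < pair c d := fun a b c d h =>
    (hS.add_sq_lt h).trans_le (le_add_of_nonneg_right (hS.nonneg c))
  have hsum : a + b = c + d := by
    rcases lt_trichotomy (a + b) (c + d) with h' | h' | h'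
    · exact absurd h (key _ _ _ _ h').ne
    · exact h'
    · exact absurd h (key _ _ _ _ h').ne'
  have hac : a = c := by simpa [pair, hsum] using h
  subst hac
  exact ⟨rfl, add_left_cancel hsum⟩

theorem ModelsRCA0.le_sq (hS : ModelsRCA0 S) (a : M) : a ≤ a ^ 2 := by
  rcases (hS.nonneg a).eq_or_lt with h | h
  · simp [← h]
  · exact le_self_pow₀ (by simpa using (hS.discrete _ _).1 h) two_ne_zero

theorem ModelsRCA0.left_lt_pair (hS : ModelsRCA0 S) (a b : M) : a < pair a b + 1 :=
  (hS.lt_succ _ _).2 (le_add_of_nonneg_left (pow_nonneg (hS.nonneg _) _))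

theorem ModelsRCA0.right_lt_pair (hS : ModelsRCA0 S) (a b : M) : b < pair a b + 1 :=
  (hS.lt_succ _ _).2 <| (le_add_of_nonneg_left (hS.nonneg a)).trans <|
    (hS.le_sq _).trans (le_add_of_nonneg_right (hS.nonneg a))

theorem ModelsRCA0.pair_le_pair (hS : ModelsRCA0 S) {a b c d : M} (h : a ≤ c) (h' : b ≤ d) :
    pair a b ≤ pair c d :=
  add_le_add (pow_le_pow_left₀ (hS.nonneg _) (add_le_add h h') 2) h

theorem ModelsRCA0.exists_add (hS : ModelsRCA0 S) {a b : M} (h : a ≤ b) : ∃ c, a + c = b := by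
  have key : ∀ b, ∃ c, a ≤ b → a + c = b := by
    refine hS.induct (A := fun b => ∃ c, a ≤ b → a + c = b) ?_ ⟨0, fun h => ?_⟩ fun b ih => ?_
    · refine .ex <| IsBdd.isSigma ?_
      with_reducible repeat' first
        | exact .var _ | exact .const _ | assumption | apply IsTermFn.pair | apply IsTermFn.add
        | apply IsTermFn.mul | apply IsBdd.mem | apply IsBdd.le | apply IsBdd.lt | apply IsBdd.eq
        | apply IsBdd.not | apply IsBdd.and | apply IsBdd.or | apply IsBdd.iff | apply IsBdd.imp
    · rw [le_antisymm h (hS.nonneg a), add_zero]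
    · obtain ⟨c, hc⟩ := ih
      by_cases hab : a ≤ b
      · exact ⟨c + 1, fun _ => by rw [← add_assoc, hc hab]⟩
      · refine ⟨0, fun hab' => ?_⟩
        rw [add_zero]
        exact le_antisymm hab' ((hS.discrete _ _).1 (not_le.1 hab))
  obtain ⟨c, hc⟩ := key b
  exact ⟨c, hc h⟩

/-- Without a least element one can descend k times from v₀ for every k, by Σ⁰₁ induction; k = v₀ +
1 is absurd. -/
theorem ModelsRCA0.exists_least (hS : ModelsRCA0 S) {A : M → Prop}
    (hA : IsSigma S fun e => A (e 0)) (h : ∃ n, A n) : ∃ n, A n ∧ ∀ k, A k → n ≤ k := by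
  by_contra! hcon
  obtain ⟨v₀, hv₀⟩ := h
  obtain ⟨v, -, hv⟩ := hS.induct (A := fun k => ∃ v, A v ∧ v + k ≤ v₀)
    (by
      apply IsSigma.ex
      exact hA.and_isBdd (.le (.add (.var _) (.var _)) (.const _)))
    ⟨v₀, hv₀, by simp⟩
    (fun k ⟨v, hv, hk⟩ => by
      obtain ⟨w, hw, hwv⟩ := hcon v hv
      exact ⟨w, hw, le_trans (by have := (hS.discrete _ _).1 hwv; grind) hk⟩) (v₀ + 1)
  exact absurd hv (not_le.2 (by have := hS.nonneg v; have := one_pos (α := M); grind))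

/-! ### Divisibility and Gödel's moduli -/

theorem ModelsRCA0.dvd_of_dvd_add (hS : ModelsRCA0 S) {u a c : M} (h : u ∣ a + c) (ha : u ∣ a) :
    u ∣ c := by
  obtain ⟨s, rfl⟩ := ha
  obtain ⟨t, ht⟩ := h
  rcases le_total s t with hst | hst
  · obtain ⟨r, rfl⟩ := hS.exists_add hst
    exact ⟨r, by rw [mul_add] at ht; exact add_left_cancel ht⟩
  · have h₁ := mul_le_mul_of_nonneg_left hst (hS.nonneg u)
    have h₂ := hS.nonneg c
    have : c = 0 := by grind
    rw [this]
    exact dvd_zero u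

theorem ModelsRCA0.exists_common_multiple (hS : ModelsRCA0 S) {r : M} (hr : 0 < r) (s b : M) :
    ∃ m, 0 < m ∧ ∀ j < b, r + s * j ∣ m := by
  have hpos : ∀ j, 0 < r + s * j := fun j =>
    add_pos_of_pos_of_nonneg hr (mul_nonneg (hS.nonneg _) (hS.nonneg _))
  obtain ⟨m, hm, h⟩ := hS.induct
    (A := fun b => ∃ m, 0 < m ∧ ∀ j < b, ∃ c < m + 1, m = (r + s * j) * c)
    (by
      refine .ex <| IsBdd.isSigma ?_
      with_reducible repeat' first
        | exact .var _ | exact .const _ | assumption | apply IsTermFn.pair | apply IsTermFn.add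
        | apply IsTermFn.mul | apply IsBdd.mem | apply IsBdd.le | apply IsBdd.lt | apply IsBdd.eq
        | apply IsBdd.not | apply IsBdd.and | apply IsBdd.or | apply IsBdd.iff | apply IsBdd.imp
        | apply IsBdd.ball | apply IsBdd.bex)
    ⟨1, one_pos, fun j hj => absurd hj (hS.nonneg j).not_gt⟩
    (fun b ⟨m, hm, h⟩ => by
      refine ⟨(r + s * b) * m, mul_pos (hpos b) hm, fun j hj => ?_⟩
      suffices hd : r + s * j ∣ (r + s * b) * m by
        obtain ⟨c, hc⟩ := hd
        refine ⟨c, (hS.lt_succ _ _).2 ?_, hc⟩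
        rw [hc]
        exact le_mul_of_one_le_left (hS.nonneg c) (by simpa using (hS.discrete _ _).1 (hpos j))
      rcases ((hS.lt_succ _ _).1 hj).lt_or_eq with hj | rfl
      · obtain ⟨c, -, hc⟩ := h j hj
        exact dvd_mul_of_dvd_right ⟨c, hc⟩ _
      · exact dvd_mul_right _ _) b
  exact ⟨m, hm, fun j hj => let ⟨c, _, hc⟩ := h j hj; ⟨c, hc⟩⟩

/-- The moduli of Gödel's `β`-function are pairwise coprime. -/
theorem ModelsRCA0.dvd_of_dvd_mul (hS : ModelsRCA0 S) {b m v w d : M}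
    (hm : ∀ j < b, 1 + 1 * j ∣ m) (hv : v < b) (hw : w < b) (hvw : v ≠ w)
    (h : 1 + m + m * v ∣ (1 + m + m * w) * d) : 1 + m + m * v ∣ d := by
  have hδ : ∀ a c δ : M, a ≠ c → c < b → a + δ = c → δ ∣ m := by
    rintro a c δ hac hc rfl
    have hδ : 0 + 1 ≤ δ :=
      (hS.discrete _ _).1 ((hS.nonneg δ).lt_of_ne fun h => hac (by rw [← h, add_zero]))
    rw [zero_add] at hδ
    obtain ⟨ε, rfl⟩ := hS.exists_add hδ
    have := hm ε (by have := hS.nonneg a; have := one_pos (α := M); grind)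
    rwa [one_mul] at this
  have key : ∃ δ, δ ∣ m ∧ 1 + m + m * v ∣ m * δ * d := by
    rcases le_total v w with hle | hle
    · obtain ⟨δ, rfl⟩ := hS.exists_add hle
      refine ⟨δ, hδ v _ δ hvw hw rfl, hS.dvd_of_dvd_add (a := (1 + m + m * v) * d) ?_
        (dvd_mul_right _ _)⟩
      convert h using 1
      ring
    · obtain ⟨δ, rfl⟩ := hS.exists_add hle
      refine ⟨δ, hδ w _ δ hvw.symm hv rfl, hS.dvd_of_dvd_add (a := (1 + m + m * w) * d) ?_ h⟩
      exact ⟨d, by ring⟩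
  obtain ⟨δ, ⟨c, hc⟩, hd⟩ := key
  -- Since δ divides m, the factor mδ can be enlarged to the square of N = m(1+v). The modulus is 1
  -- + N, so each factor N can then be cancelled.
  have h₂ : 1 + m + m * v ∣ (m * (1 + v)) * (m * (1 + v)) * d := by
    convert hd.mul_right (c * (1 + v) ^ 2) using 1
    nth_rw 2 [hc]
    ring
  have h₁ : 1 + m + m * v ∣ (m * (1 + v)) * d :=
    hS.dvd_of_dvd_add ⟨m * (1 + v) * d, by ring⟩ h₂
  exact hS.dvd_of_dvd_add ⟨d, by ring⟩ h₁

/-! ### Functions and relations of the model as predicates -/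

theorem ModelsRCA0.exists_graph (hS : ModelsRCA0 S) {g : M → M} (hg : IsFunction S g) :
    ∃ G ∈ S, ∀ n u, pair n u ∈ G ↔ u = g n := by
  refine ⟨_, hg, fun n u => ⟨?_, fun h => ⟨n, by rw [h]⟩⟩⟩
  rintro ⟨k, hk⟩
  obtain ⟨rfl, h⟩ := hS.pair_inj.1 hk
  exact h

theorem ModelsRCA0.isRelation (hS : ModelsRCA0 S) {r : M → M → Prop}
    (h : ∀ i j, IsSigma S fun e => r (e i) (e j))
    (h' : ∀ i j, IsSigma S fun e => ¬ r (e i) (e j)) : IsRelation S r := by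
  refine hS.mem_of_isSigma (A := fun z => ∃ a b, r a b ∧ z = pair a b) ?_ ?_
  · apply IsSigma.ex
    apply IsSigma.ex
    exact (h _ _).and_isBdd (.eq (.var _) (.pair (.var _) (.var _)))
  -- A number outside the set either codes a pair failing `r` or codes no pair; the latter is
  -- bounded because components do not exceed the code.
  · have : IsSigma S fun e => (∃ a b, ¬ r a b ∧ e 0 = pair a b) ∨
        ¬ ∃ a < e 0 + 1, ∃ b < e 0 + 1, e 0 = pair a b := by
      refine .or ?_ (by
        refine IsBdd.isSigma ?_
        with_reducible repeat' first
          | exact .var _ | exact .const _ | assumption | apply IsTermFn.pair | apply IsTermFn.add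
          | apply IsTermFn.mul | apply IsBdd.mem | apply IsBdd.le | apply IsBdd.lt
          | apply IsBdd.eq | apply IsBdd.not | apply IsBdd.and | apply IsBdd.or | apply IsBdd.iff
          | apply IsBdd.imp | apply IsBdd.ball | apply IsBdd.bex)
      apply IsSigma.ex
      apply IsSigma.ex
      exact (h' _ _).and_isBdd (.eq (.var _) (.pair (.var _) (.var _)))
    refine this.congr fun e => ⟨?_, fun hn => ?_⟩
    · rintro (⟨a, b, hab, h₀⟩ | hn) ⟨c, d, hcd, h₁⟩
      · obtain ⟨rfl, rfl⟩ := hS.pair_inj.1 (h₀.symm.trans h₁)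
        exact hab hcd
      · exact hn ⟨c, h₁ ▸ hS.left_lt_pair c d, d, h₁ ▸ hS.right_lt_pair c d, h₁⟩
    · by_contra! hcon
      obtain ⟨a, -, b, -, hab⟩ := hcon.2
      exact hn ⟨a, b, by_contra fun hr => hcon.1 a b hr hab, hab⟩

theorem ModelsRCA0.isBdd_rel (hS : ModelsRCA0 S) {r : M → M → Prop} (hr : IsRelation S r)
    {s t : (ℕ → M) → M} (hs : IsTermFn s) (ht : IsTermFn t) :
    IsBdd S (fun e => r (s e) (t e)) := by
  refine (IsBdd.mem hr (hs.pair ht)).congr fun e => ⟨?_, fun h => ⟨_, _, h, rfl⟩⟩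
  rintro ⟨a, b, hab, h⟩
  obtain ⟨h₁, h₂⟩ := hS.pair_inj.1 h
  rwa [h₁, h₂]

/-- An injection of the model is unbounded on every final segment. -/
theorem ModelsRCA0.exists_ge (hS : ModelsRCA0 S) {g : M → M} (hg : IsFunction S g)
    (hinj : Function.Injective g) (i b : M) : ∃ j, i < j ∧ b ≤ g j := by
  by_contra! hcon
  obtain ⟨G, hG, hmem⟩ := hS.exists_graph hg
  obtain ⟨m, hm, hdm⟩ := hS.exists_common_multiple one_pos 1 b
  obtain ⟨C, hC, hdC⟩ := hS.exists_common_multiple (add_pos one_pos hm) m b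
  -- The number d records which values below b are unused: it is divisible by the modulus of each of
  -- them. Each new value of g divides its own modulus out of d, keeping the others by coprimality
  -- and shrinking d by at least 1, which cannot happen C + 1 times.
  obtain ⟨d, -, hd, -⟩ := hS.induct (A := fun k => ∃ d, 0 < d ∧ d + k ≤ C ∧
      ∀ v < b, (∀ j < k, pair (i + 1 + j) v ∉ G) → ∃ c < d + 1, d = (1 + m + m * v) * c)
    (by
      refine .ex <| IsBdd.isSigma ?_
      with_reducible repeat' first
        | exact .var _ | exact .const _ | assumption | apply IsTermFn.pair | apply IsTermFn.add
        | apply IsTermFn.mul | apply IsBdd.mem | apply IsBdd.le | apply IsBdd.lt | apply IsBdd.eq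
        | apply IsBdd.not | apply IsBdd.and | apply IsBdd.or | apply IsBdd.iff | apply IsBdd.imp
        | apply IsBdd.ball | apply IsBdd.bex)
    (by
      refine ⟨C, hC, by simp, fun v hv _ => ?_⟩
      obtain ⟨c, hc⟩ := hdC v hv
      refine ⟨c, (hS.lt_succ _ _).2 ?_, hc⟩
      rw [hc]
      exact le_mul_of_one_le_left (hS.nonneg c)
        (by have := mul_nonneg hm.le (hS.nonneg v); have := hm.le; grind))
    (fun k ⟨d, hd, hk, h⟩ => by
      have hgk : i < i + 1 + k := by have := hS.nonneg k; have := one_pos (α := M); grind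
      obtain ⟨c, -, hc⟩ := h (g (i + 1 + k)) (hcon _ hgk) fun j hj hjG =>
        absurd (hinj ((hmem _ _).1 hjG)) (by grind)
      have hc₀ : 0 < c := by
        refine (hS.nonneg c).lt_of_ne ?_
        rintro rfl
        simp [hc] at hd
      have hcd : c + 1 ≤ d := by
        refine (hS.discrete _ _).1 ?_
        rw [hc]
        refine lt_mul_of_one_lt_left hc₀ ?_
        have := mul_nonneg hm.le (hS.nonneg (g (i + 1 + k)))
        grind
      refine ⟨c, hc₀, by grind, fun v hv hvG => ?_⟩
      have hvk : v ≠ g (i + 1 + k) := fun h' =>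
        hvG k ((hS.lt_succ _ _).2 le_rfl) ((hmem _ _).2 h')
      obtain ⟨c', -, hc'⟩ := h v hv fun j hj => hvG j (hj.trans (lt_add_one k))
      obtain ⟨c'', hc''⟩ := hS.dvd_of_dvd_mul hdm hv (hcon _ hgk) hvk ⟨c', hc ▸ hc'⟩
      refine ⟨c'', (hS.lt_succ _ _).2 ?_, hc''⟩
      rw [hc'']
      exact le_mul_of_one_le_left (hS.nonneg c'')
        (by have := mul_nonneg hm.le (hS.nonneg v); have := hm.le; grind)) (C + 1)
  exact absurd hd (not_le.2 (by have := hS.nonneg d; have := one_pos (α := M); grind))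

end SOA

namespace SOA

variable {M : Type*} [CommSemiring M] [LinearOrder M] [IsStrictOrderedRing M] {S : Set (Set M)}

/-! ### True stages -/

omit [CommSemiring M] [IsStrictOrderedRing M] in
theorem trueAt_trans {f : M → M} {i m n : M} (h : i ∈ trueAt f m) (h' : m ∈ trueAt f n) :
    i ∈ trueAt f n := by
  refine ⟨h.1.trans h'.1, fun k hik hkn => ?_⟩
  rcases le_or_gt k m with hkm | hmk
  · exact h.2 k hik hkm
  · exact (h.2 m h.1 le_rfl).trans (h'.2 k hmk hkn)

omit [CommSemiring M] [IsStrictOrderedRing M] in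
theorem trueAt_of_le {f : M → M} {i m n : M} (h : i ∈ trueAt f n) (him : i < m) (hmn : m ≤ n) :
    i ∈ trueAt f m :=
  ⟨him, fun k hik hkm => h.2 k hik (hkm.trans hmn)⟩

/-- The values of f are not terms, so the comparison is only Δ⁰₁ in the graph. Comprehension turns
it into a set of the model, after which it counts as atomic. -/
theorem ModelsRCA0.isBdd_map_lt (hS : ModelsRCA0 S) {f : M → M} (hf : IsFunction S f)
    {s t : (ℕ → M) → M} (hs : IsTermFn s) (ht : IsTermFn t) :
    IsBdd S (fun e => f (s e) < f (t e)) := by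
  obtain ⟨F, hF, hmem⟩ := hS.exists_graph hf
  refine hS.isBdd_rel (r := fun n k => f n < f k) (hS.isRelation (fun i j => ?_) fun i j => ?_)
    hs ht
  · have : IsSigma S fun e => ∃ u v, pair (e i) u ∈ F ∧ pair (e j) v ∈ F ∧ u < v := by
      refine .ex <| .ex <| IsBdd.isSigma ?_
      with_reducible repeat' first
        | exact .var _ | exact .const _ | assumption | apply IsTermFn.pair | apply IsTermFn.add
        | apply IsTermFn.mul | apply IsBdd.mem | apply IsBdd.le | apply IsBdd.lt | apply IsBdd.eq
        | apply IsBdd.not | apply IsBdd.and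
    exact this.congr fun e => by simp [hmem]
  · have : IsSigma S fun e => ∃ u v, pair (e i) u ∈ F ∧ pair (e j) v ∈ F ∧ ¬ u < v := by
      refine .ex <| .ex <| IsBdd.isSigma ?_
      with_reducible repeat' first
        | exact .var _ | exact .const _ | assumption | apply IsTermFn.pair | apply IsTermFn.add
        | apply IsTermFn.mul | apply IsBdd.mem | apply IsBdd.le | apply IsBdd.lt | apply IsBdd.eq
        | apply IsBdd.not | apply IsBdd.and
    exact this.congr fun e => by simp [hmem]

theorem ModelsRCA0.isBdd_trueAt (hS : ModelsRCA0 S) {f : M → M} (hf : IsFunction S f)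
    {s t : (ℕ → M) → M} (hs : IsTermFn s) (ht : IsTermFn t) :
    IsBdd S (fun e => s e ∈ trueAt f (t e)) := by
  have hf' := @hS.isBdd_map_lt _ _ _ _ _ f hf
  have : ∀ i j, IsBdd S fun e => e i < e j ∧ ∀ k < e j + 1, e i < k → f (e i) < f k := by
    intro i j
    with_reducible repeat' first
      | apply hf' | exact .var _ | exact .const _ | assumption | apply IsTermFn.pair
      | apply IsTermFn.add | apply IsTermFn.mul | apply IsBdd.mem | apply IsBdd.le
      | apply IsBdd.lt | apply IsBdd.eq | apply IsBdd.not | apply IsBdd.and | apply IsBdd.or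
      | apply IsBdd.iff | apply IsBdd.imp | apply IsBdd.ball
  refine hS.isBdd_rel (r := fun n s => n ∈ trueAt f s) ?_ hs ht
  have : ∀ i j, IsBdd S fun e => e i ∈ trueAt f (e j) := fun i j =>
    (this i j).congr fun e => by simp only [trueAt, Set.mem_ofPred_eq, hS.lt_succ]; grind
  exact hS.isRelation (fun i j => (this i j).isSigma) fun i j => (this i j).not.isSigma

theorem ModelsRCA0.trueAt_succ_cases (hS : ModelsRCA0 S) {f : M → M} (hf : IsFunction S f)
    (s : M) :
    (∃ n₀, trueAt f (s + 1) ⊂ trueAt f s ∪ {s} ∧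
      IsLeast ((trueAt f s ∪ {s}) \ trueAt f (s + 1)) n₀) ∨
    trueAt f (s + 1) = trueAt f s ∪ {s} := by
  have hsub : trueAt f (s + 1) ⊆ trueAt f s ∪ {s} := fun n hn => by
    rcases ((hS.lt_succ _ _).1 hn.1).lt_or_eq with h | h
    · exact .inl (trueAt_of_le hn h (lt_add_one s).le)
    · exact .inr h
  rcases hsub.ssubset_or_eq with h | h
  · left
    obtain ⟨n, hn, hn'⟩ := Set.exists_of_ssubset h
    have hf' := @hS.isBdd_trueAt _ _ _ _ _ f hf
    obtain ⟨n₀, h₀, hmin⟩ := hS.exists_least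
      (A := fun n => (n ∈ trueAt f s ∨ n = s) ∧ n ∉ trueAt f (s + 1))
      (by
        refine IsBdd.isSigma ?_
        with_reducible repeat' first
          | apply hf' | exact .var _ | exact .const _ | assumption | apply IsTermFn.pair
          | apply IsTermFn.add | apply IsTermFn.mul | apply IsBdd.mem | apply IsBdd.le
          | apply IsBdd.lt | apply IsBdd.eq | apply IsBdd.not | apply IsBdd.and | apply IsBdd.or)
      ⟨n, hn, hn'⟩
    exact ⟨n₀, h, h₀, hmin⟩
  · exact .inr h

/-! ### Placing a new copy -/

section

omit [CommSemiring M] [LinearOrder M] [IsStrictOrderedRing M]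

/-- The three alternatives for y against w are exhaustive, so the clauses amount to equivalences
that determine every comparison of y with z. -/
theorem placedAbove_iff {le : M → M → Prop} {D Z : Set M} {w : M} :
    PlacedAbove le D Z w ↔
      ∀ y ∈ D, ∀ z ∈ Z, (le y z ↔ le y w) ∧ (le z y ↔ Lt le w y) := by
  unfold PlacedAbove Lt Incomp
  refine forall₂_congr fun y _ => forall₂_congr fun z _ => ?_
  tauto

theorem placedBelow_iff {le : M → M → Prop} {D Z : Set M} {w : M} :
    PlacedBelow le D Z w ↔
      ∀ y ∈ D, ∀ z ∈ Z, (le y z ↔ Lt le y w) ∧ (le z y ↔ le w y) := by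
  unfold PlacedBelow Lt Incomp
  refine forall₂_congr fun y _ => forall₂_congr fun z _ => ?_
  tauto

end

theorem ModelsRCA0.mem_copiesUpTo_succ (hS : ModelsRCA0 S) {P : Set M} {s z : M} :
    z ∈ copiesUpTo P (s + 1) ↔ z ∈ copiesUpTo P s ∨ z ∈ copy P (s + 1) := by
  constructor
  · rintro ⟨n, hn, hz⟩
    rcases hn.lt_or_eq with h | rfl
    · exact .inl ⟨n, (hS.lt_succ _ _).1 h, hz⟩
    · exact .inr hz
  · rintro (⟨n, hn, hz⟩ | hz)
    · exact ⟨n, hn.trans (lt_add_one s).le, hz⟩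
    · exact ⟨_, le_rfl, hz⟩

theorem ModelsRCA0.mem_copiesUpTo_zero (hS : ModelsRCA0 S) {P : Set M} {z : M} :
    z ∈ copiesUpTo P 0 ↔ z ∈ copy P 0 := by
  constructor
  · rintro ⟨n, hn, hz⟩
    rwa [le_antisymm hn (hS.nonneg n)] at hz
  · exact fun hz => ⟨0, le_rfl, hz⟩

theorem ModelsRCA0.isBdd_copiesUpTo (hS : ModelsRCA0 S) {P : Set M} (hP : P ∈ S)
    {s t : (ℕ → M) → M} (hs : IsTermFn s) (ht : IsTermFn t) :
    IsBdd S (fun e => s e ∈ copiesUpTo P (t e)) := by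
  refine hS.isBdd_rel (r := fun z s => z ∈ copiesUpTo P s) ?_ hs ht
  have : ∀ i j, IsBdd S fun e => ∃ n < e j + 1, ∃ p < e i + 1, p ∈ P ∧ e i = pair n p := by
    intro i j
    with_reducible repeat' first
      | exact .var _ | exact .const _ | assumption | apply IsTermFn.pair | apply IsTermFn.add
      | apply IsTermFn.mul | apply IsBdd.mem | apply IsBdd.le | apply IsBdd.lt | apply IsBdd.eq
      | apply IsBdd.not | apply IsBdd.and | apply IsBdd.or | apply IsBdd.iff | apply IsBdd.imp
      | apply IsBdd.ball | apply IsBdd.bex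
  have : ∀ i j, IsBdd S fun e => e i ∈ copiesUpTo P (e j) := fun i j =>
    (this i j).congr fun e => by
      constructor
      · rintro ⟨n, hn, p, -, hp, h⟩
        exact ⟨n, (hS.lt_succ _ _).1 hn, p, hp, h⟩
      · rintro ⟨n, hn, p, hp, h⟩
        exact ⟨n, (hS.lt_succ _ _).2 hn, p, h ▸ hS.right_lt_pair n p, hp, h⟩
  exact hS.isRelation (fun i j => (this i j).isSigma) fun i j => (this i j).not.isSigma

theorem ModelsRCA0.lt_of_mem_copiesUpTo (hS : ModelsRCA0 S) {P : Set M} {k s z : M}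
    (hk : ∀ i ∈ P, i < k) (hz : z ∈ copiesUpTo P s) : z < pair s k + 1 := by
  obtain ⟨n, hn, p, hp, rfl⟩ := hz
  exact (hS.lt_succ _ _).2 (hS.pair_le_pair hn (hk p hp).le)

/-! ### Uniqueness and the order axioms -/

section

variable {f : M → M} {P : Set M} {leP : M → M → Prop} {x : M} {Q : Set M} {leQ : M → M → Prop}

omit [IsStrictOrderedRing M] in
theorem IsXi.exists_mem_copiesUpTo (h : IsXi S f P leP x Q leQ) {a : M} (ha : a ∈ Q) :
    ∃ n, ∀ s, n ≤ s → a ∈ copiesUpTo P s := by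
  obtain ⟨n, hn⟩ := (h.domain a).1 ha
  exact ⟨n, fun s hs => ⟨n, hs, hn⟩⟩

/-- The reference element w and the case depend on f and s alone, so two candidate orders can be
compared at the same w. -/
theorem ModelsRCA0.stage_cases (hS : ModelsRCA0 S) (hf : IsFunction S f) (P : Set M)
    (leP : M → M → Prop) (hx : x ∈ P) (s : M) :
    ∃ w ∈ copiesUpTo P s,
      (∀ Q leQ, IsXi S f P leP x Q leQ → ∀ y ∈ copiesUpTo P s, ∀ z ∈ copy P (s + 1),
        (leQ y z ↔ leQ y w) ∧ (leQ z y ↔ Lt leQ w y)) ∨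
      (∀ Q leQ, IsXi S f P leP x Q leQ → ∀ y ∈ copiesUpTo P s, ∀ z ∈ copy P (s + 1),
        (leQ y z ↔ Lt leQ y w) ∧ (leQ z y ↔ leQ w y)) := by
  rcases hS.trueAt_succ_cases hf s with ⟨n₀, h, h₀⟩ | h
  · refine ⟨pair n₀ x, ⟨n₀, ?_, x, hx, rfl⟩, .inl fun Q leQ hQ =>
      placedAbove_iff.1 (hQ.above s n₀ h h₀)⟩
    rcases h₀.1.1 with h | h
    exacts [h.1.le, h.le]
  · exact ⟨pair s x, ⟨s, le_rfl, x, hx, rfl⟩, .inr fun Q leQ hQ =>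
      placedBelow_iff.1 (hQ.below s h)⟩

theorem IsXi.unique (hS : ModelsRCA0 S) (hf : IsFunction S f) (hP : P ∈ S) (hfin : IsFinite P)
    (hx : x ∈ P) {Q' : Set M} {leQ' : M → M → Prop} (h : IsXi S f P leP x Q leQ)
    (h' : IsXi S f P leP x Q' leQ') : Q' = Q ∧ leQ' = leQ := by
  obtain rfl : Q' = Q := Set.ext fun z => (h'.domain z).trans (h.domain z).symm
  refine ⟨rfl, ?_⟩
  obtain ⟨k, hk⟩ := hfin
  have hbdd := @hS.isBdd_copiesUpTo _ _ _ _ _ P hP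
  have hle := @hS.isBdd_rel _ _ _ _ _ leQ h.isRelation
  have hle' := @hS.isBdd_rel _ _ _ _ _ leQ' h'.isRelation
  -- As k bounds P, all elements of the first copies are at most `pair s k`; the explicit bounds
  -- make the induction hypothesis Σ⁰₀.
  have key : ∀ s, ∀ a < pair s k + 1, ∀ b < pair s k + 1, a ∈ copiesUpTo P s →
      b ∈ copiesUpTo P s → (leQ' a b ↔ leQ a b) := by
    refine hS.induct (A := fun s => ∀ a < pair s k + 1, ∀ b < pair s k + 1, a ∈ copiesUpTo P s →
      b ∈ copiesUpTo P s → (leQ' a b ↔ leQ a b)) ?_ ?_ fun s ih => ?_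
    · refine IsBdd.isSigma ?_
      with_reducible repeat' first
        | apply hbdd | apply hle | apply hle' | exact .var _ | exact .const _ | assumption
        | apply IsTermFn.pair | apply IsTermFn.add | apply IsTermFn.mul | apply IsBdd.mem
        | apply IsBdd.le | apply IsBdd.lt | apply IsBdd.eq | apply IsBdd.not | apply IsBdd.and
        | apply IsBdd.or | apply IsBdd.iff | apply IsBdd.imp | apply IsBdd.ball
    · intro a _ b _ ha hb
      rw [hS.mem_copiesUpTo_zero] at ha hb
      obtain ⟨p, hp, rfl⟩ := ha
      obtain ⟨q, hq, rfl⟩ := hb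
      rw [h.onCopy _ p hp q hq, h'.onCopy _ p hp q hq]
    · replace ih : ∀ a ∈ copiesUpTo P s, ∀ b ∈ copiesUpTo P s, (leQ' a b ↔ leQ a b) :=
        fun a ha b hb => ih a (hS.lt_of_mem_copiesUpTo hk ha) b (hS.lt_of_mem_copiesUpTo hk hb)
          ha hb
      intro a _ b _ ha hb
      rw [hS.mem_copiesUpTo_succ] at ha hb
      obtain ⟨w, hw, hcases⟩ := hS.stage_cases hf P leP hx s
      have key : ∀ y ∈ copiesUpTo P s, ∀ z ∈ copy P (s + 1),
          (leQ' y z ↔ leQ y z) ∧ (leQ' z y ↔ leQ z y) := fun y hy z hz => by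
        rcases hcases with hc | hc
        · have h₁ := hc _ _ h y hy z hz
          have h₂ := hc _ _ h' y hy z hz
          rw [h₁.1, h₁.2, h₂.1, h₂.2, Lt, Lt, ih y hy w hw, ih w hw y hy]
          exact ⟨.rfl, .rfl⟩
        · have h₁ := hc _ _ h y hy z hz
          have h₂ := hc _ _ h' y hy z hz
          rw [h₁.1, h₁.2, h₂.1, h₂.2, Lt, Lt, ih y hy w hw, ih w hw y hy]
          exact ⟨.rfl, .rfl⟩
      rcases ha with ha | ha <;> rcases hb with hb | hb
      · exact ih a ha b hb
      · exact (key a ha b hb).1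
      · exact (key b hb a ha).2
      · obtain ⟨p, hp, rfl⟩ := ha
        obtain ⟨q, hq, rfl⟩ := hb
        rw [h.onCopy _ p hp q hq, h'.onCopy _ p hp q hq]
  funext a b
  by_cases hab : a ∈ Q' ∧ b ∈ Q'
  · obtain ⟨m, hm⟩ := h.exists_mem_copiesUpTo hab.1
    obtain ⟨n, hn⟩ := h.exists_mem_copiesUpTo hab.2
    have ha := hm (max m n) (le_max_left _ _)
    have hb := hn (max m n) (le_max_right _ _)
    exact propext (key _ a (hS.lt_of_mem_copiesUpTo hk ha) b (hS.lt_of_mem_copiesUpTo hk hb) ha hb)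
  · exact propext ⟨fun hle => absurd (h'.supp a b hle) hab, fun hle => absurd (h.supp a b hle) hab⟩

theorem IsXi.isPartialOrder (hS : ModelsRCA0 S) (hf : IsFunction S f)
    (hP : IsPartialOrder S P leP) (hfin : IsFinite P) (hx : x ∈ P)
    (h : IsXi S f P leP x Q leQ) : IsPartialOrder S Q leQ := by
  obtain ⟨k, hk⟩ := hfin
  have hbdd := @hS.isBdd_copiesUpTo _ _ _ _ _ P hP.mem
  have hle := @hS.isBdd_rel _ _ _ _ _ leQ h.isRelation
  have hcopy : ∀ n, ∀ a ∈ copy P n, ∀ b ∈ copy P n, leQ a b →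
      (leQ b a → a = b) ∧ ∀ c ∈ copy P n, leQ b c → leQ a c := by
    rintro n _ ⟨p, hp, rfl⟩ _ ⟨q, hq, rfl⟩ hab
    rw [h.onCopy n p hp q hq] at hab
    refine ⟨fun hba => ?_, ?_⟩
    · rw [h.onCopy n q hq p hp] at hba
      rw [hP.antisymm p q hab hba]
    · rintro _ ⟨r, hr, rfl⟩ hbc
      rw [h.onCopy n q hq r hr] at hbc
      rw [h.onCopy n p hp r hr]
      exact hP.trans p q r hab hbc
  have key : ∀ s, ∀ a < pair s k + 1, ∀ b < pair s k + 1, a ∈ copiesUpTo P s →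
      b ∈ copiesUpTo P s → leQ a b →
      (leQ b a → a = b) ∧ ∀ c < pair s k + 1, c ∈ copiesUpTo P s → leQ b c → leQ a c := by
    refine hS.induct (A := fun s => ∀ a < pair s k + 1, ∀ b < pair s k + 1, a ∈ copiesUpTo P s →
      b ∈ copiesUpTo P s → leQ a b →
      (leQ b a → a = b) ∧ ∀ c < pair s k + 1, c ∈ copiesUpTo P s → leQ b c → leQ a c)
      ?_ ?_ fun s ih => ?_
    · refine IsBdd.isSigma ?_
      with_reducible repeat' first
        | apply hbdd | apply hle | exact .var _ | exact .const _ | assumption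
        | apply IsTermFn.pair | apply IsTermFn.add | apply IsTermFn.mul | apply IsBdd.mem
        | apply IsBdd.le | apply IsBdd.lt | apply IsBdd.eq | apply IsBdd.not | apply IsBdd.and
        | apply IsBdd.or | apply IsBdd.iff | apply IsBdd.imp | apply IsBdd.ball
    · intro a _ b _ ha hb hab
      rw [hS.mem_copiesUpTo_zero] at ha hb
      exact ⟨(hcopy 0 a ha b hb hab).1, fun c _ hc =>
        (hcopy 0 a ha b hb hab).2 c (hS.mem_copiesUpTo_zero.1 hc)⟩
    · replace ih : ∀ a ∈ copiesUpTo P s, ∀ b ∈ copiesUpTo P s, leQ a b →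
          (leQ b a → a = b) ∧ ∀ c ∈ copiesUpTo P s, leQ b c → leQ a c := by
        intro a ha b hb hab
        have := ih a (hS.lt_of_mem_copiesUpTo hk ha) b (hS.lt_of_mem_copiesUpTo hk hb) ha hb hab
        exact ⟨this.1, fun c hc => this.2 c (hS.lt_of_mem_copiesUpTo hk hc) hc⟩
      intro a _ b _ ha hb hab
      simp only [hS.mem_copiesUpTo_succ] at ha hb ⊢
      -- Comparisons between old and new elements reduce to comparisons with w, where the hypothesis
      -- applies; those inside the new copy are settled by `hcopy`.
      obtain ⟨w, hw, hcases⟩ := hS.stage_cases hf P leP hx s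
      have hcopy := hcopy (s + 1)
      rcases hcases with hc | hc <;> replace hc := hc _ _ h <;> unfold Lt at hc <;>
        refine ⟨fun hba => ?_, fun c _ hcs hbc => ?_⟩
      · rcases ha with ha | ha <;> rcases hb with hb | hb <;> grind
      · rcases ha with ha | ha <;> rcases hb with hb | hb <;> rcases hcs with hcs | hcs <;> grind
      · rcases ha with ha | ha <;> rcases hb with hb | hb <;> grind
      · rcases ha with ha | ha <;> rcases hb with hb | hb <;> rcases hcs with hcs | hcs <;> grind
  have hmax : ∀ a b c, a ∈ Q → b ∈ Q → c ∈ Q → ∃ s, a ∈ copiesUpTo P s ∧ b ∈ copiesUpTo P s ∧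
      c ∈ copiesUpTo P s := fun a b c ha hb hc => by
    obtain ⟨l, hl⟩ := h.exists_mem_copiesUpTo ha
    obtain ⟨m, hm⟩ := h.exists_mem_copiesUpTo hb
    obtain ⟨n, hn⟩ := h.exists_mem_copiesUpTo hc
    exact ⟨max l (max m n), hl _ (by simp), hm _ (by simp), hn _ (by simp)⟩
  refine ⟨⟨h.mem, h.isRelation, h.supp, fun a ha => ?_, fun a b c hab hbc => ?_⟩,
    fun a b hab hba => ?_⟩
  · obtain ⟨n, p, hp, rfl⟩ := (h.domain a).1 ha
    exact (h.onCopy n p hp p hp).2 (hP.refl p hp)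
  · obtain ⟨s, ha, hb, hc⟩ := hmax a b c (h.supp _ _ hab).1 (h.supp _ _ hab).2 (h.supp _ _ hbc).2
    exact (key s a (hS.lt_of_mem_copiesUpTo hk ha) b (hS.lt_of_mem_copiesUpTo hk hb) ha hb hab).2 c
      (hS.lt_of_mem_copiesUpTo hk hc) hc hbc
  · obtain ⟨s, ha, hb, -⟩ := hmax a b b (h.supp _ _ hab).1 (h.supp _ _ hab).2 (h.supp _ _ hab).2
    exact (key s a (hS.lt_of_mem_copiesUpTo hk ha) b (hS.lt_of_mem_copiesUpTo hk hb) ha hb hab).1 hba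

end

end SOA

namespace SOA

variable {M : Type*} [CommSemiring M] [LinearOrder M] [IsStrictOrderedRing M] {S : Set (Set M)}

/-! ### Existence -/

section

variable {f : M → M} {P : Set M} {leP : M → M → Prop} {x : M}

/-- The element `p` of the `m`-th copy is below the element `q` of the `n`-th copy. For `m < n` the
`n`-th copy lies immediately below `x_m` if `m` is true at `n`, otherwise immediately above `x_m` if
every number true at `m` is true at `n`, and otherwise above the whole of the `m`-th copy. -/
def XiRel (f : M → M) (leP : M → M → Prop) (x m p n q : M) : Prop :=
  (m = n ∧ leP p q) ∨
  (m < n ∧ ((m ∈ trueAt f n ∧ leP p x ∧ ¬ leP x p) ∨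
    (m ∉ trueAt f n ∧ ((∃ i < m, i ∈ trueAt f m ∧ i ∉ trueAt f n) ∨ leP p x)))) ∨
  (n < m ∧ ((n ∈ trueAt f m ∧ leP x q) ∨
    (n ∉ trueAt f m ∧ (¬ ∃ i < n, i ∈ trueAt f n ∧ i ∉ trueAt f m) ∧ leP x q ∧ ¬ leP q x)))

/-- The order of `Ξ_f(P, x)`. -/
def XiLe (f : M → M) (P : Set M) (leP : M → M → Prop) (x a b : M) : Prop :=
  ∃ m p n q, p ∈ P ∧ q ∈ P ∧ a = pair m p ∧ b = pair n q ∧ XiRel f leP x m p n q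

theorem ModelsRCA0.xiLe_iff (hS : ModelsRCA0 S) {m p n q : M} (hp : p ∈ P) (hq : q ∈ P) :
    XiLe f P leP x (pair m p) (pair n q) ↔ XiRel f leP x m p n q := by
  refine ⟨?_, fun h => ⟨m, p, n, q, hp, hq, rfl, rfl, h⟩⟩
  rintro ⟨m', p', n', q', -, -, h₁, h₂, h⟩
  obtain ⟨rfl, rfl⟩ := hS.pair_inj.1 h₁
  obtain ⟨rfl, rfl⟩ := hS.pair_inj.1 h₂
  exact h

theorem ModelsRCA0.isRelation_xiLe (hS : ModelsRCA0 S) (hf : IsFunction S f)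
    (hP : IsPartialOrder S P leP) : IsRelation S (XiLe f P leP x) := by
  have hT := @hS.isBdd_trueAt _ _ _ _ _ f hf
  have hleP := @hS.isBdd_rel _ _ _ _ _ leP hP.isRelation
  have hPS := hP.mem
  have hrel : ∀ i j k l, IsBdd S fun e => XiRel f leP x (e i) (e j) (e k) (e l) := by
    intro i j k l
    unfold XiRel
    with_reducible repeat' first
      | apply hT | apply hleP | exact .var _ | exact .const _ | assumption | apply IsTermFn.pair
      | apply IsTermFn.add | apply IsTermFn.mul | apply IsBdd.mem | apply IsBdd.le
      | apply IsBdd.lt | apply IsBdd.eq | apply IsBdd.not | apply IsBdd.and | apply IsBdd.or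
      | apply IsBdd.iff | apply IsBdd.imp | apply IsBdd.ball | apply IsBdd.bex
  have : ∀ i j, IsBdd S fun e => ∃ m < e i + 1, ∃ p < e i + 1, ∃ n < e j + 1, ∃ q < e j + 1,
      p ∈ P ∧ q ∈ P ∧ e i = pair m p ∧ e j = pair n q ∧ XiRel f leP x m p n q := by
    intro i j
    with_reducible repeat' first
      | apply hrel | exact .var _ | exact .const _ | assumption | apply IsTermFn.pair
      | apply IsTermFn.add | apply IsTermFn.mul | apply IsBdd.mem | apply IsBdd.le
      | apply IsBdd.lt | apply IsBdd.eq | apply IsBdd.not | apply IsBdd.and | apply IsBdd.or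
      | apply IsBdd.iff | apply IsBdd.imp | apply IsBdd.ball | apply IsBdd.bex
  have : ∀ i j, IsBdd S fun e => XiLe f P leP x (e i) (e j) := fun i j =>
    (this i j).congr fun e => by
      constructor
      · rintro ⟨m, -, p, -, n, -, q, -, h⟩
        exact ⟨m, p, n, q, h⟩
      · rintro ⟨m, p, n, q, hp, hq, h₁, h₂, h⟩
        exact ⟨m, h₁ ▸ hS.left_lt_pair m p, p, h₁ ▸ hS.right_lt_pair m p, n,
          h₂ ▸ hS.left_lt_pair n q, q, h₂ ▸ hS.right_lt_pair n q, hp, hq, h₁, h₂, h⟩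
  exact hS.isRelation (fun i j => (this i j).isSigma) fun i j => (this i j).not.isSigma

theorem ModelsRCA0.isXi_xiLe (hS : ModelsRCA0 S) (hf : IsFunction S f)
    (hP : IsPartialOrder S P leP) (hx : x ∈ P) :
    IsXi S f P leP x {z | ∃ n, z ∈ copy P n} (XiLe f P leP x) := by
  have hxx := hP.refl x hx
  refine ⟨?_, hS.isRelation_xiLe hf hP, ?_, fun z => .rfl, fun n p hp p' hp' => ?_,
    fun s n₀ hss hn₀ => ?_, fun s hs => ?_⟩
  · have hPS := hP.mem
    have : IsBdd S fun e => ∃ n < e 0 + 1, ∃ p < e 0 + 1, p ∈ P ∧ e 0 = pair n p := by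
      with_reducible repeat' first
        | exact .var _ | exact .const _ | assumption | apply IsTermFn.pair | apply IsTermFn.add
        | apply IsTermFn.mul | apply IsBdd.mem | apply IsBdd.le | apply IsBdd.lt | apply IsBdd.eq
        | apply IsBdd.not | apply IsBdd.and | apply IsBdd.or | apply IsBdd.iff | apply IsBdd.imp
        | apply IsBdd.ball | apply IsBdd.bex
    refine hS.mem_of_isBdd (this.congr fun e => ?_)
    constructor
    · rintro ⟨n, -, p, -, hp, h⟩
      exact ⟨n, p, hp, h⟩
    · rintro ⟨n, p, hp, h⟩
      exact ⟨n, h ▸ hS.left_lt_pair n p, p, h ▸ hS.right_lt_pair n p, hp, h⟩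
  · rintro _ _ ⟨m, p, n, q, hp, hq, rfl, rfl, -⟩
    exact ⟨⟨m, p, hp, rfl⟩, ⟨n, q, hq, rfl⟩⟩
  · rw [hS.xiLe_iff hp hp']
    simp [XiRel]
  · rw [placedAbove_iff]
    rintro _ ⟨n, hn, p, hp, rfl⟩ _ ⟨q, hq, rfl⟩
    obtain ⟨⟨h₀, h₀'⟩, hmin⟩ := hn₀
    have hn₀s : n₀ ≤ s := by
      rcases h₀ with h | h
      exacts [h.1.le, h.le]
    -- Stage s + 1 is compared with n₀ in three ranges of n. Below n₀, truth at n₀ and at s + 1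
    -- agree (`hlow`), so n relates to both alike. At n₀ itself no earlier truth is lost. Strictly
    -- after n₀, the loss of n₀ puts all of P_n below the new copy, while n₀ being true at n already
    -- puts P_n below x_{n₀}.
    have hstack : ∀ m, n₀ < m → m ≤ s → n₀ ∈ trueAt f m := by
      rcases h₀ with h | rfl
      · exact fun m => trueAt_of_le h
      · exact fun m h h' => absurd h h'.not_gt
    have hlow : ∀ i < n₀, i ∈ trueAt f n₀ ↔ i ∈ trueAt f (s + 1) := fun i hi => by
      refine ⟨fun h => ?_, fun h => trueAt_of_le h hi (hn₀s.trans (lt_add_one s).le)⟩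
      by_contra hcon
      refine absurd (hmin ⟨.inl ?_, hcon⟩) hi.not_ge
      rcases h₀ with h' | rfl
      · exact trueAt_trans h h'
      · exact h
    have hns : n < s + 1 := (hS.lt_succ _ _).2 hn
    simp only [Lt, hS.xiLe_iff hp hq, hS.xiLe_iff hq hp, hS.xiLe_iff hp hx, hS.xiLe_iff hx hp]
    rcases lt_trichotomy n n₀ with h | rfl | h
    · have hW : (∃ i < n, i ∈ trueAt f n ∧ i ∉ trueAt f n₀) ↔
          ∃ i < n, i ∈ trueAt f n ∧ i ∉ trueAt f (s + 1) :=
        exists_congr fun i => and_congr_right fun hi => by rw [hlow i (hi.trans h)]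
      simp only [XiRel, hns, hns.ne, hns.ne', hns.not_gt, h, h.ne, h.ne', h.not_gt, hW, hlow n h]
      grind
    · have hW : ¬ ∃ i < n, i ∈ trueAt f n ∧ i ∉ trueAt f (s + 1) := by
        rintro ⟨i, hi, h, h'⟩
        exact h' ((hlow i hi).1 h)
      simp only [XiRel, hns, hns.ne, hns.ne', hns.not_gt, lt_irrefl, hW, h₀']
      grind
    · have hW : ∃ i < n, i ∈ trueAt f n ∧ i ∉ trueAt f (s + 1) := ⟨n₀, h, hstack n h hn, h₀'⟩
      have hn' : n ∉ trueAt f (s + 1) := fun h' => h₀' (trueAt_trans (hstack n h hn) h')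
      simp only [XiRel, hns, hns.ne, hns.ne', hns.not_gt, h, h.ne, h.ne', h.not_gt, hW, hn',
        hstack n h hn]
      grind
  · rw [placedBelow_iff]
    rintro _ ⟨n, hn, p, hp, rfl⟩ _ ⟨q, hq, rfl⟩
    have hlow : ∀ i < s, i ∈ trueAt f (s + 1) ↔ i ∈ trueAt f s := fun i hi => by
      rw [hs]
      exact or_iff_left hi.ne
    have hns : n < s + 1 := (hS.lt_succ _ _).2 hn
    simp only [Lt, hS.xiLe_iff hp hq, hS.xiLe_iff hq hp, hS.xiLe_iff hp hx, hS.xiLe_iff hx hp]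
    rcases hn.lt_or_eq with h | rfl
    · have hW : (∃ i < n, i ∈ trueAt f n ∧ i ∉ trueAt f (s + 1)) ↔
          ∃ i < n, i ∈ trueAt f n ∧ i ∉ trueAt f s :=
        exists_congr fun i => and_congr_right fun hi => by rw [hlow i (hi.trans h)]
      simp only [XiRel, hns, hns.ne, hns.ne', hns.not_gt, h, h.ne, h.ne', h.not_gt, hW, hlow n h]
      grind
    · have hn' : n ∈ trueAt f (n + 1) := by
        rw [hs]
        exact .inr rfl
      simp only [XiRel, hns, hns.ne, hns.ne', hns.not_gt, lt_irrefl, hn']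
      grind

/-! ### Bad sequences -/

/-- A bad sequence yields the range of `f`: it visits arbitrarily late copies, so every number that
is true at the index of a visited copy stays true forever. -/
theorem ModelsRCA0.range_mem_of_bad (hS : ModelsRCA0 S) (hf : IsFunction S f)
    (hinj : Function.Injective f) (hfin : IsFinite P) {q : M → M} (hq : IsFunction S q)
    (hqP : ∀ i, ∃ n, q i ∈ copy P n)
    (hbad : ∀ i j, i < j → ¬ XiLe f P leP x (q i) (q j))
    (hrefl : ∀ i, XiLe f P leP x (q i) (q i)) : {n | ∃ m, f m = n} ∈ S := by
  obtain ⟨k, hk⟩ := hfin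
  have hqinj : Function.Injective q := fun i j hij => by
    rcases lt_trichotomy i j with h | h | h
    · exact absurd (hij ▸ hrefl i) (hbad i j h)
    · exact h
    · exact absurd (hij ▸ hrefl i) (hbad j i h)
  -- Elements of copies with index at most b have codes at most `pair b k`, and the injection q
  -- exceeds this after any i.
  have hlate : ∀ i b, ∃ j, i < j ∧ ∃ n p, p ∈ P ∧ q j = pair n p ∧ b < n := fun i b => by
    obtain ⟨j, hij, hj⟩ := hS.exists_ge hq hqinj i (pair b k + 1)
    obtain ⟨n, p, hp, hn⟩ := hqP j
    refine ⟨j, hij, n, p, hp, hn, lt_of_not_ge fun hnb => hj.not_gt ?_⟩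
    rw [hn]
    exact (hS.lt_succ _ _).2 (hS.pair_le_pair hnb (hk p hp).le)
  have htrue : ∀ i n p a, q i = pair n p → a ∈ trueAt f n → ∀ l, a < l → f a < f l := by
    intro i n p a hi ha l hal
    by_contra hcon
    obtain ⟨j, hij, n', p', hp', hj, hn'⟩ := hlate i (max l n)
    obtain ⟨n₁, p₁, hp₁, h₁⟩ := hqP i
    obtain ⟨rfl, rfl⟩ := hS.pair_inj.1 (hi.symm.trans h₁)
    rw [max_lt_iff] at hn'
    -- The copy n' is past the witness l, so a has become false; by transitivity n is false at n'
    -- too, and `q i` lies below `q j`.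
    have ha' : a ∉ trueAt f n' := fun h => hcon (h.2 l hal hn'.1.le)
    refine hbad i j hij ?_
    rw [hi, hj, hS.xiLe_iff hp₁ hp']
    exact .inr (.inl ⟨hn'.2, .inr ⟨fun h => ha' (trueAt_trans ha h), .inl ⟨a, ha.1, ha, ha'⟩⟩⟩)
  obtain ⟨F, hF, hmem⟩ := hS.exists_graph hf
  obtain ⟨G, hG, hmem'⟩ := hS.exists_graph hq
  have hT := @hS.isBdd_trueAt _ _ _ _ _ f hf
  have hnext : ∀ b, ∃ a, b ≤ a ∧ ∃ i n p, pair i (pair n p) ∈ G ∧ a ∈ trueAt f n := fun b => by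
    -- A point where f is minimal on [b, ∞) is true at every later stage, in particular at the index
    -- of a visited copy beyond it.
    obtain ⟨v, ⟨a, hba, hav⟩, hmin⟩ := hS.exists_least (A := fun v => ∃ a, b ≤ a ∧ pair a v ∈ F)
      (by
        refine .ex <| IsBdd.isSigma ?_
        with_reducible repeat' first
          | exact .var _ | exact .const _ | assumption | apply IsTermFn.pair | apply IsTermFn.add
          | apply IsTermFn.mul | apply IsBdd.mem | apply IsBdd.le | apply IsBdd.lt
          | apply IsBdd.eq | apply IsBdd.not | apply IsBdd.and)
      ⟨f b, b, le_rfl, (hmem _ _).2 rfl⟩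
    rw [hmem] at hav
    obtain ⟨j, -, n, p, -, hj, han⟩ := hlate 0 a
    refine ⟨a, hba, j, n, p, (hmem' _ _).2 hj.symm, han, fun l hal _ => ?_⟩
    rw [← hav]
    refine (hmin (f l) ⟨l, hba.trans hal.le, (hmem _ _).2 rfl⟩).lt_of_ne ?_
    rw [hav]
    exact hinj.ne hal.ne
  have hlarge : ∀ k, ∃ a i n p u, pair i (pair n p) ∈ G ∧ a ∈ trueAt f n ∧ pair a u ∈ F ∧
      k ≤ u := by
    refine hS.induct (A := fun k => ∃ a i n p u, pair i (pair n p) ∈ G ∧ a ∈ trueAt f n ∧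
      pair a u ∈ F ∧ k ≤ u) ?_ ?_ ?_
    · refine .ex <| .ex <| .ex <| .ex <| .ex <| IsBdd.isSigma ?_
      with_reducible repeat' first
        | apply hT | exact .var _ | exact .const _ | assumption | apply IsTermFn.pair
        | apply IsTermFn.add | apply IsTermFn.mul | apply IsBdd.mem | apply IsBdd.le
        | apply IsBdd.lt | apply IsBdd.eq | apply IsBdd.not | apply IsBdd.and
    · obtain ⟨a, -, i, n, p, h, ha⟩ := hnext 0
      exact ⟨a, i, n, p, f a, h, ha, (hmem _ _).2 rfl, hS.nonneg _⟩
    · rintro k ⟨a, i, n, p, u, h, ha, hu, hku⟩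
      obtain ⟨a', haa', i', n', p', h', ha'⟩ := hnext (a + 1)
      refine ⟨a', i', n', p', f a', h', ha', (hmem _ _).2 rfl, (hS.discrete _ _).1 ?_⟩
      rw [hmem] at hu
      rw [hmem'] at h
      exact (hu ▸ hku).trans_lt
        (htrue i n p a h.symm ha a' ((lt_add_one a).trans_le haa'))
  refine hS.mem_of_isSigma (A := fun n => ∃ m, f m = n) ?_ ?_
  · have : IsSigma S fun e => ∃ m, pair m (e 0) ∈ F := by
      refine .ex <| IsBdd.isSigma ?_
      with_reducible repeat' first
        | exact .var _ | exact .const _ | assumption | apply IsTermFn.pair | apply IsTermFn.add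
        | apply IsTermFn.mul | apply IsBdd.mem
    exact this.congr fun e => by simp only [hmem, eq_comm]
  -- Once a is certified as true with f(a) above the given number, later values of f are larger
  -- still, so only arguments up to a need checking.
  · have : IsSigma S fun e => ∃ a i n p u, pair i (pair n p) ∈ G ∧ a ∈ trueAt f n ∧
        pair a u ∈ F ∧ e 0 + 1 ≤ u ∧ ∀ m < a + 1, pair m (e 0) ∉ F := by
      refine .ex <| .ex <| .ex <| .ex <| .ex <| IsBdd.isSigma ?_
      with_reducible repeat' first
        | apply hT | exact .var _ | exact .const _ | assumption | apply IsTermFn.pair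
        | apply IsTermFn.add | apply IsTermFn.mul | apply IsBdd.mem | apply IsBdd.le
        | apply IsBdd.lt | apply IsBdd.eq | apply IsBdd.not | apply IsBdd.and | apply IsBdd.or
        | apply IsBdd.iff | apply IsBdd.imp | apply IsBdd.ball
    refine this.congr fun e => ⟨?_, fun hn => ?_⟩
    · rintro ⟨a, i, n, p, u, h, ha, hu, hku, hm⟩ ⟨m, hm'⟩
      rw [hmem] at hu
      rw [hmem'] at h
      rcases le_or_gt m a with hma | ham
      · exact hm m ((hS.lt_succ _ _).2 hma) ((hmem _ _).2 hm'.symm)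
      · have h₁ := htrue i n p a h.symm ha m ham
        rw [hm', ← hu] at h₁
        exact h₁.not_gt ((hS.discrete _ _).2 hku)
    · obtain ⟨a, i, n, p, u, h, ha, hu, hku⟩ := hlarge (e 0 + 1)
      exact ⟨a, i, n, p, u, h, ha, hu, hku, fun m _ hm => hn ⟨m, ((hmem _ _).1 hm).symm⟩⟩

end

end SOA

/-- Provability in `RCA₀` is rendered as truth in every model `(M, S)` of `RCA₀`; every function,
relation and set below is one of the model. -/
theorem lemma4p3 {M : Type*} [CommSemiring M] [LinearOrder M] [IsStrictOrderedRing M]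
    (S : Set (Set M)) (hS : SOA.ModelsRCA0 S)
    (f : M → M) (hf : SOA.IsFunction S f) (hinj : Function.Injective f)
    (P : Set M) (leP : M → M → Prop) (hP : SOA.IsPartialOrder S P leP) (hfin : SOA.IsFinite P)
    (x : M) (hx : x ∈ P) :
    ∃ (Q : Set M) (leQ : M → M → Prop),
      SOA.IsXi S f P leP x Q leQ ∧
      (∀ (Q' : Set M) (leQ' : M → M → Prop),
        SOA.IsXi S f P leP x Q' leQ' → Q' = Q ∧ leQ' = leQ) ∧
      SOA.IsPartialOrder S Q leQ ∧
      (¬ SOA.IsWQO S Q leQ → {n | ∃ m, f m = n} ∈ S) := by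
  have hXi := hS.isXi_xiLe hf hP hx
  have hQ := hXi.isPartialOrder hS hf hP hfin hx
  refine ⟨_, _, hXi, fun Q' leQ' h => hXi.unique hS hf hP.mem hfin hx h, hQ, fun hwqo => ?_⟩
  obtain ⟨q, hq, hqQ, hbad⟩ : ∃ q : M → M, SOA.IsFunction S q ∧ (∀ n, ∃ k, q n ∈ SOA.copy P k) ∧
      ∀ m n, m < n → ¬ SOA.XiLe f P leP x (q m) (q n) := by
    by_contra! hcon
    exact hwqo ⟨hQ.toIsQuasiOrder, hcon⟩
  exact hS.range_mem_of_bad hf hinj hfin hq hqQ hbad fun i => hQ.refl _ (hqQ i)
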